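/- Let $\kappa_P,\kappa_S>0$ be wave-numbers, let $K\ge 0$ and $N_r$ be integers with $2K+1\le N_r$, and let $H^{(1)}_m=J_m+iY_m$ be the Hankel function of the first kind of integer order $m$. For $\mathbf x\in\mathbb R^2\setminus\{\mathbf 0\}$ with polar angle $\varphi_{\mathbf x}$ put $v_m(\mathbf x,\kappa)=H^{(1)}_m(\kappa|\mathbf x|)e^{im\varphi_{\mathbf x}}$ and $$\mathbf H^P_m=\nabla v_m(\cdot,\kappa_P),\qquad \mathbf H^S_m=\big(\partial_2 v_m(\cdot,\kappa_S),\,-\partial_1 v_m(\cdot,\kappa_S)\big)^\top .$$ For $R>0$ let $\mathbf x_r=R(\cos\theta_r,\sin\theta_r)$ with $\theta_r=2\pi r/N_r$, $r=1,\dots,N_r$, and let $\mathbf d_r,\mathbf d_r^\perp\in\mathbb R^2$ be unit vectors with $\mathbf d_r\cdot\mathbf d_r^\perp=0$. For $\alpha\in\{P,S\}$ let $\mathbf Y^\alpha_\parallel,\mathbf Y^\alpha_\perp\in\mathbb C^{N_r\times(2K+1)}$ have the entries $$(\mathbf Y^\alpha_\parallel)_{rn}=\overline{\mathbf H^\alpha_n(\mathbf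 x_r)}\cdot\mathbf d_r,\qquad (\mathbf Y^\alpha_\perp)_{rn}=\overline{\mathbf H^\alpha_n(\mathbf x_r)}\cdot\mathbf d_r^\perp,\qquad -K\le n\le K,$$ and put $$\mathbf Y=\begin{pmatrix}\mathbf Y^P_\parallel&\mathbf Y^S_\parallel\\ \mathbf Y^P_\perp&\mathbf Y^S_\perp\end{pmatrix}\in\mathbb C^{2N_r\times(4K+2)},\qquad \mathbf Z_{\mathbf Y}=\begin{pmatrix}\mathbf C^{P,P}&\mathbf O\\ \mathbf O&\mathbf D^{S,S}\end{pmatrix},$$ where $\mathbf C^{P,P}=\mathrm{diag}\big(g^P_m\overline{g^P_m}\big)_{m=-K}^{K}$ and $\mathbf D^{S,S}=\mathrm{diag}\big(h^S_m\overline{h^S_m}\big)_{m=-K}^{K}$ with $$g^P_m=\kappa_P\,(H^{(1)}_m)'(\kappa_P R),\qquad h^S_m=-\kappa_S\,(H^{(1)}_m)'(\kappa_S R).$$ Then there are constants $C>0$ and $R_0>0$, depending only on $\kappa_P,\kappa_S,K,N_r$ (in particular not on $R$ or on the directions $\mathbf d_r,\mathbf d_r^\perp$), such that for all $R\ge R_0$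 and all such directions $$\mathbf Y^*\mathbf Y=N_r\,\mathbf Z_{\mathbf Y}+\mathbf Q$$ with a matrix $\mathbf Q=(q_{\ell\ell'})\in\mathbb C^{(4K+2)\times(4K+2)}$ satisfying $|q_{\ell\ell'}|\le C R^{-2}$ for all $\ell,\ell'$. -/

import Mathlib

open scoped Matrix ComplexConjugate

noncomputable section

namespace ElasticScattering

/-- The Bessel function of the first kind `J_n` of integer order, by Bessel's integral. -/
def besselJ (n : ℤ) (t : ℝ) : ℝ :=
  (1 / Real.pi) * ∫ τ in (0 : ℝ)..Real.pi, Real.cos (n * τ - t * Real.sin τ)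

/-- The Bessel function of the second kind (Neumann function) `Y_n` of integer order at a real
argument `t > 0`, by the Schlaefli-Sommerfeld integral. -/
def besselY (n : ℤ) (t : ℝ) : ℝ :=
  (1 / Real.pi) * (∫ τ in (0 : ℝ)..Real.pi, Real.sin (t * Real.sin τ - n * τ))
    - (1 / Real.pi) * ∫ u in Set.Ioi (0 : ℝ),
        (Real.exp (n * u) + (-1 : ℝ) ^ n * Real.exp (-(n * u))) * Real.exp (-(t * Real.sinh u))

/-- The Hankel function of the first kind `H⁽¹⁾_n = J_n + i Y_n`, for `t > 0`. -/
def hankel (n : ℤ) (t : ℝ) : ℂ :=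
  (besselJ n t : ℂ) + Complex.I * (besselY n t : ℂ)

/-- The Euclidean plane. -/
abbrev Plane : Type := EuclideanSpace ℝ (Fin 2)

/-- The polar angle of a point of the plane. It is normalized to `(-π, π]`; it is only used through
`exp (i m φ)` with an integer `m`, which does not depend on the normalization. -/
def polarAngle (x : Plane) : ℝ := Complex.arg ⟨x 0, x 1⟩

/-- The radiating wave function `v_m(x, κ) = H⁽¹⁾_m(κ|x|) exp(i m φ_x)`. -/
def waveV (m : ℤ) (κ : ℝ) (x : Plane) : ℂ :=
  hankel m (κ * ‖x‖) * Complex.exp (Complex.I * (m : ℂ) * (polarAngle x : ℂ))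

/-- The partial derivative `∂_j f` of a complex-valued function on the plane. -/
def partialDeriv (j : Fin 2) (f : Plane → ℂ) (x : Plane) : ℂ :=
  fderiv ℝ f x (EuclideanSpace.single j (1 : ℝ))

/-- The gradient `∇f = (∂₁f, ∂₂f)`. -/
def grad (f : Plane → ℂ) (x : Plane) : Fin 2 → ℂ :=
  ![partialDeriv 0 f x, partialDeriv 1 f x]

/-- The vector-valued curl `(∂₂f, -∂₁f)` of a scalar function. -/
def curl (f : Plane → ℂ) (x : Plane) : Fin 2 → ℂ :=
  ![partialDeriv 1 f x, -partialDeriv 0 f x]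

/-- The two elastic wave modes: pressure `P` and shear `S`. -/
inductive WaveMode
  | P
  | S

/-- The exterior cylindrical eigenvectors `H^P_m = ∇ v_m(·, κ_P)` and `H^S_m = curl v_m(·, κ_S)` of
the Lamé system. -/
def cylH (κ : WaveMode → ℝ) : WaveMode → ℤ → Plane → Fin 2 → ℂ
  | .P, m, x => grad (waveV m (κ .P)) x
  | .S, m, x => curl (waveV m (κ .S)) x

/-- The order `n = -K, …, K` attached to the column `j = 0, …, 2K`. -/
def order (K : ℕ) (j : Fin (2 * K + 1)) : ℤ := (j : ℤ) - (K : ℤ)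

/-- The receiver `x_r = R (cos θ_r, sin θ_r)` with `θ_r = 2π r / N`, `r = 1, …, N`
(the index `r : Fin N` stands for the receiver number `r + 1`). -/
def receiver (N : ℕ) (R : ℝ) (r : Fin N) : Plane :=
  !₂[R * Real.cos (2 * Real.pi * ((r : ℝ) + 1) / N), R * Real.sin (2 * Real.pi * ((r : ℝ) + 1) / N)]

/-- The matrix with entries `conj (H^α_n(x_r)) · d_r`, for `r = 1, …, N` and `n = -K, …, K`. -/
def matYBlock (κ : WaveMode → ℝ) (K N : ℕ) (R : ℝ) (d : Fin N → Plane) (α : WaveMode) :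
    Matrix (Fin N) (Fin (2 * K + 1)) ℂ :=
  Matrix.of fun r j => ∑ i : Fin 2, conj (cylH κ α (order K j) (receiver N R r) i) * ((d r i : ℝ) : ℂ)

/-- The `2N × (4K+2)` block matrix `Y`; the first row of blocks uses the directions `d_r`, the second
row the directions `d_r^⊥`. -/
def matY (κ : WaveMode → ℝ) (K N : ℕ) (R : ℝ) (d dPerp : Fin N → Plane) :
    Matrix (Fin N ⊕ Fin N) (Fin (2 * K + 1) ⊕ Fin (2 * K + 1)) ℂ :=
  Matrix.fromBlocks
    (matYBlock κ K N R d .P) (matYBlock κ K N R d .S)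
    (matYBlock κ K N R dPerp .P) (matYBlock κ K N R dPerp .S)

/-- `g^P_m = κ_P (H⁽¹⁾_m)'(κ_P R)` and `g^S_m = (i m / R) H⁽¹⁾_m(κ_S R)`. -/
def coeffG (κ : WaveMode → ℝ) (R : ℝ) : WaveMode → ℤ → ℂ
  | .P, m => (κ .P : ℂ) * deriv (hankel m) (κ .P * R)
  | .S, m => Complex.I * (m : ℂ) / (R : ℂ) * hankel m (κ .S * R)

/-- `h^P_m = (i m / R) H⁽¹⁾_m(κ_P R)` and `h^S_m = -κ_S (H⁽¹⁾_m)'(κ_S R)`. -/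
def coeffH (κ : WaveMode → ℝ) (R : ℝ) : WaveMode → ℤ → ℂ
  | .P, m => Complex.I * (m : ℂ) / (R : ℂ) * hankel m (κ .P * R)
  | .S, m => -((κ .S : ℂ) * deriv (hankel m) (κ .S * R))

/-- `C^{α,β} = diag (g^α_m conj(g^β_m))`, `m = -K, …, K`. -/
def matC (κ : WaveMode → ℝ) (K : ℕ) (R : ℝ) (α β : WaveMode) :
    Matrix (Fin (2 * K + 1)) (Fin (2 * K + 1)) ℂ :=
  Matrix.diagonal fun j => coeffG κ R α (order K j) * conj (coeffG κ R β (order K j))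

/-- `D^{α,β} = diag (h^α_m conj(h^β_m))`, `m = -K, …, K`. -/
def matD (κ : WaveMode → ℝ) (K : ℕ) (R : ℝ) (α β : WaveMode) :
    Matrix (Fin (2 * K + 1)) (Fin (2 * K + 1)) ℂ :=
  Matrix.diagonal fun j => coeffH κ R α (order K j) * conj (coeffH κ R β (order K j))

/-- The block-diagonal matrix `Z_Y` with diagonal blocks `C^{P,P}` and `D^{S,S}`. -/
def matZ (κ : WaveMode → ℝ) (K : ℕ) (R : ℝ) :
    Matrix (Fin (2 * K + 1) ⊕ Fin (2 * K + 1)) (Fin (2 * K + 1) ⊕ Fin (2 * K + 1)) ℂ :=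
  Matrix.fromBlocks (matC κ K R .P .P) 0 0 (matD κ K R .S .S)

end ElasticScattering

end

open scoped Matrix ComplexConjugate

/-! In the orthonormal polar frame at `x_r`, both eigenvector families have the form `exp (i m θ_r)`
times a vector with radial component `g^α_m` and tangential component `h^α_m`, neither depending on
`r`. Projecting on `d_r` and `d_r^⊥` and summing recovers the full product of two eigenvectors, so
the directions drop out of `Y*Y`. An entry is then `g conj g' + h conj h'` times a character sum
over the `N` equispaced angles. The sum is `N` or `0`, because frequencies differ by at most `2K <
N`. Hence each block of `Y*Y` is exactly diagonal (`gram_apply`).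

What `N Z` leaves over is `h^P conj h^P`, `g^S conj g^S` and the mixed `P`-`S` products. Here `g^P`
and `h^S` are `O(R^(-1/2))`, while `h^P` and `g^S` carry an extra `1/R`. The leftovers are thus
`O(R^(-3))` in the diagonal blocks and `O(R^(-2))` in the mixed ones.

The analytic input is that `H⁽¹⁾_m` and its derivative are `O(t^(-1/2))` (`exists_hankel_bound`). In
the integral representation, the oscillatory part is handled by a van der Corput estimate and the
damped part is `O(1/t)`. Differentiating in `t` only changes the amplitudes, so the same estimates
cover the derivative. -/

namespace ElasticScattering

/-! ### Oscillatory integrals with a nondegenerate stationary point -/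

section VanDerCorput

open MeasureTheory intervalIntegral Set

/-- The second-derivative van der Corput bound for the phase `t cos s` on a half-period. -/
theorem norm_integral_mul_exp_cos_le {b b' : ℝ → ℂ} {M t : ℝ} (hM : 0 ≤ M) (ht : 1 ≤ t)
    (hb : ∀ s, HasDerivAt b (b' s) s) (hb'c : Continuous b')
    (hbM : ∀ s, ‖b s‖ ≤ M) (hb'M : ∀ s, ‖b' s‖ ≤ M) :
    ‖∫ s in (0 : ℝ)..(Real.pi / 2), b s * Complex.exp (Complex.I * (t * Real.cos s : ℝ))‖
      ≤ M * (1 + Real.pi + Real.pi ^ 2 / 2) / √t := by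
  have hbc : Continuous b := continuous_iff_continuousAt.2 fun s => (hb s).continuousAt
  have hpi := Real.pi_gt_three
  -- The phase is stationary at `0`. Cut at the scale `t^(-1/2)`: the trivial bound serves below it,
  -- integration by parts above it, where `sin s ≥ 2s/π`.
  set δ : ℝ := 1 / √t with hδ
  have hst : 1 ≤ √t := Real.one_le_sqrt.2 ht
  have hst0 : 0 < √t := by linarith
  have hδ0 : 0 < δ := by positivity
  have hδ1 : δ ≤ 1 := by rw [hδ, div_le_one hst0]; exact hst
  have ht0 : 0 < t := by linarith
  have hle : δ ≤ Real.pi / 2 := by linarith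
  set e : ℝ → ℂ := fun s => Complex.exp (Complex.I * (t * Real.cos s : ℝ)) with he
  have hec : Continuous e := by simp only [he]; fun_prop
  have hen : ∀ s, ‖e s‖ = 1 := fun s => by
    simp only [he]; rw [mul_comm]; exact Complex.norm_exp_ofReal_mul_I _
  have hed : ∀ s, HasDerivAt e (e s * (Complex.I * (t * -Real.sin s : ℝ))) s := fun s =>
    (((Real.hasDerivAt_cos s).const_mul t).ofReal_comp.const_mul Complex.I).cexp
  have hint : ∀ a c : ℝ, IntervalIntegrable (fun s => b s * e s) volume a c := fun a c =>
    (hbc.mul hec).intervalIntegrable a c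
  have hsin : ∀ s ∈ Icc δ (Real.pi / 2), 2 / Real.pi * s ≤ Real.sin s := fun s hs =>
    Real.mul_le_sin (hδ0.le.trans hs.1) hs.2
  have hsin0 : ∀ s ∈ Icc δ (Real.pi / 2), 0 < Real.sin s := fun s hs =>
    lt_of_lt_of_le (mul_pos (by positivity) (hδ0.trans_le hs.1)) (hsin s hs)
  have hinv : ∀ s ∈ Icc δ (Real.pi / 2), 1 / Real.sin s ≤ Real.pi / 2 * (1 / s) := fun s hs => by
    have hs0 : 0 < s := hδ0.trans_le hs.1
    calc 1 / Real.sin s ≤ 1 / (2 / Real.pi * s) :=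
          one_div_le_one_div_of_le (by positivity) (hsin s hs)
      _ = _ := by field_simp
  have h1 : ‖∫ s in (0 : ℝ)..δ, b s * e s‖ ≤ M * δ := by
    have := intervalIntegral.norm_integral_le_of_norm_le_const (a := 0) (b := δ)
      (f := fun s => b s * e s) (C := M) (fun s _ => by
        rw [norm_mul, hen, mul_one]; exact hbM s)
    simpa [abs_of_pos hδ0] using this
  -- `F` is the boundary term of the integration by parts, and `G` is the error in `F' = b e + G`.
  set F : ℝ → ℂ := fun s => b s * e s * (Complex.I / t) * ((1 / Real.sin s : ℝ) : ℂ) with hF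
  set G : ℝ → ℂ := fun s => e s * (Complex.I / t) *
    (b' s * ((1 / Real.sin s : ℝ) : ℂ) - b s * ((Real.cos s / Real.sin s ^ 2 : ℝ) : ℂ)) with hG
  have hFd : ∀ s ∈ Icc δ (Real.pi / 2), HasDerivAt F (b s * e s + G s) s := fun s hs => by
    have h0 := (hsin0 s hs).ne'
    have h2 : HasDerivAt (fun s => 1 / Real.sin s) (-Real.cos s / Real.sin s ^ 2) s := by
      simp only [one_div]
      exact (Real.hasDerivAt_sin s).inv h0
    have h3 := (((hb s).mul (hed s)).mul_const (Complex.I / t)).mul h2.ofReal_comp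
    refine h3.congr_deriv ?_
    simp only [hG, Pi.mul_apply]
    have h0' : (Real.sin s : ℂ) ≠ 0 := by exact_mod_cast h0
    have ht' : (t : ℂ) ≠ 0 := by exact_mod_cast ht0.ne'
    push_cast at h0' ⊢
    field_simp
    ring_nf
    simp only [Complex.I_sq]
    ring
  have hGc : ContinuousOn G (Icc δ (Real.pi / 2)) := by
    have hs : ContinuousOn (fun s => 1 / Real.sin s) (Icc δ (Real.pi / 2)) :=
      continuousOn_const.div Real.continuous_sin.continuousOn fun s hs => (hsin0 s hs).ne'
    have hs2 : ContinuousOn (fun s => Real.cos s / Real.sin s ^ 2) (Icc δ (Real.pi / 2)) :=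
      Real.continuous_cos.continuousOn.div (Real.continuous_sin.pow 2).continuousOn
        fun s hs => pow_ne_zero 2 (hsin0 s hs).ne'
    exact (hec.mul continuous_const).continuousOn.mul
      ((hb'c.continuousOn.mul (Complex.continuous_ofReal.comp_continuousOn hs)).sub
        (hbc.continuousOn.mul (Complex.continuous_ofReal.comp_continuousOn hs2)))
  have hGi : IntervalIntegrable G volume δ (Real.pi / 2) :=
    (hGc.mono (by rw [uIcc_of_le hle])).intervalIntegrable
  have hFTC : (∫ s in δ..(Real.pi / 2), b s * e s) = F (Real.pi / 2) - F δ
      - ∫ s in δ..(Real.pi / 2), G s := by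
    rw [eq_sub_iff_add_eq, ← intervalIntegral.integral_add (hint _ _) hGi]
    exact intervalIntegral.integral_eq_sub_of_hasDerivAt
      (fun s hs => hFd s (by rwa [uIcc_of_le hle] at hs)) ((hint _ _).add hGi)
  have hIt : ‖Complex.I / (t : ℂ)‖ = 1 / t := by
    rw [norm_div, Complex.norm_I, Complex.norm_real, Real.norm_of_nonneg ht0.le]
  have hFb : ∀ s ∈ Icc δ (Real.pi / 2), ‖F s‖ ≤ M * (Real.pi / 2) * δ := fun s hs => by
    have hs0 : 0 < s := hδ0.trans_le hs.1
    simp only [hF]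
    rw [norm_mul, norm_mul, norm_mul, hen, hIt, Complex.norm_real,
      Real.norm_of_nonneg (by have := hsin0 s hs; positivity)]
    calc ‖b s‖ * 1 * (1 / t) * (1 / Real.sin s)
        ≤ M * 1 * (1 / t) * (Real.pi / 2 * (1 / δ)) := by
          gcongr
          · exact (one_div_pos.2 (hsin0 s hs)).le
          · exact hbM s
          · refine (hinv s hs).trans ?_
            gcongr
            exact hs.1
      _ = M * (Real.pi / 2) * δ := by
          have : t = √t * √t := (Real.mul_self_sqrt ht0.le).symm
          rw [hδ]; nth_rewrite 1 [this]; field_simp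
  have hGb : ‖∫ s in δ..(Real.pi / 2), G s‖ ≤ M * (Real.pi ^ 2 / 2) * δ := by
    have hz : (0 : ℝ) ∉ uIcc δ (Real.pi / 2) := by
      rw [uIcc_of_le hle]; exact fun h => absurd h.1 (not_le.2 hδ0)
    have hi : IntervalIntegrable (fun s : ℝ => M * (Real.pi ^ 2 / 2) / t * s ^ (-2 : ℤ)) volume
        δ (Real.pi / 2) :=
      (intervalIntegral.intervalIntegrable_zpow (Or.inr hz)).const_mul _
    have := intervalIntegral.norm_integral_le_of_norm_le hle (f := G)
      (Filter.Eventually.of_forall fun s hs => ?_) hi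
    · refine this.trans ?_
      rw [intervalIntegral.integral_const_mul, integral_zpow (Or.inr ⟨by norm_num, hz⟩)]
      have e1 : ((Real.pi / 2) ^ (-2 + 1 : ℤ) - δ ^ (-2 + 1 : ℤ)) / ((-2 : ℤ) + 1 : ℝ)
          = 1 / δ - 1 / (Real.pi / 2) := by norm_num; ring
      rw [e1]
      have e2 : M * (Real.pi ^ 2 / 2) * δ = M * (Real.pi ^ 2 / 2) / t * (1 / δ) := by
        have : t = √t * √t := (Real.mul_self_sqrt ht0.le).symm
        rw [hδ]; nth_rewrite 2 [this]; field_simp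
      rw [e2]
      have : 0 ≤ 1 / (Real.pi / 2) := by positivity
      gcongr
      linarith
    · have hs' : s ∈ Icc δ (Real.pi / 2) := Ioc_subset_Icc_self hs
      have hs0 : 0 < s := hδ0.trans_le hs'.1
      have hsp := hsin0 s hs'
      -- Since `sin s ≤ 1`, the `b'` term is also dominated by `1 / sin² s`, so a single multiple of
      -- `s^(-2)` bounds all of `G`.
      have h1s : 1 ≤ 1 / Real.sin s := by
        rw [le_div_iff₀ hsp, one_mul]; exact Real.sin_le_one s
      have hi2 : 1 / Real.sin s ≤ (1 / Real.sin s) ^ 2 := by nlinarith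
      have hi3 : (1 / Real.sin s) ^ 2 ≤ (Real.pi / 2 * (1 / s)) ^ 2 := by
        have := hinv s hs'
        gcongr
      have hc : |Real.cos s / Real.sin s ^ 2| ≤ (1 / Real.sin s) ^ 2 := by
        rw [abs_div, abs_of_pos (pow_pos hsp 2), div_pow, one_pow]
        gcongr
        exact Real.abs_cos_le_one s
      have hA : ‖b' s * ((1 / Real.sin s : ℝ) : ℂ)‖ ≤ M * (Real.pi / 2 * (1 / s)) ^ 2 := by
        rw [norm_mul, Complex.norm_real, Real.norm_of_nonneg (by positivity)]
        exact mul_le_mul (hb'M s) (hi2.trans hi3) (by positivity) hM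
      have hB : ‖b s * ((Real.cos s / Real.sin s ^ 2 : ℝ) : ℂ)‖
          ≤ M * (Real.pi / 2 * (1 / s)) ^ 2 := by
        rw [norm_mul, Complex.norm_real, Real.norm_eq_abs]
        exact mul_le_mul (hbM s) (hc.trans hi3) (by positivity) hM
      simp only [hG]
      rw [norm_mul, norm_mul, hen, hIt, one_mul]
      calc 1 / t * ‖_‖ ≤ 1 / t * (M * (Real.pi / 2 * (1 / s)) ^ 2
            + M * (Real.pi / 2 * (1 / s)) ^ 2) := by
            gcongr
            exact (norm_sub_le _ _).trans (add_le_add hA hB)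
        _ = _ := by rw [zpow_neg]; norm_cast; field_simp; ring
  rw [← intervalIntegral.integral_add_adjacent_intervals (hint 0 δ) (hint δ (Real.pi / 2)), hFTC]
  have hfa := hFb _ (right_mem_Icc.2 hle)
  have hfb := hFb _ (left_mem_Icc.2 hle)
  calc _ ≤ M * δ + (M * (Real.pi / 2) * δ + M * (Real.pi / 2) * δ
          + M * (Real.pi ^ 2 / 2) * δ) := by
        refine (norm_add_le _ _).trans (add_le_add h1 ?_)
        refine (norm_sub_le _ _).trans (add_le_add ?_ hGb)
        exact (norm_sub_le _ _).trans (add_le_add hfa hfb)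
    _ = _ := by rw [hδ]; ring

/-- The van der Corput bound for the phase `t sin τ` on `[0, π]`. -/
theorem norm_integral_mul_exp_sin_le {a a' : ℝ → ℂ} {M t : ℝ} (hM : 0 ≤ M) (ht : 1 ≤ t)
    (ha : ∀ s, HasDerivAt a (a' s) s) (ha'c : Continuous a')
    (haM : ∀ s, ‖a s‖ ≤ M) (ha'M : ∀ s, ‖a' s‖ ≤ M) :
    ‖∫ s in (0 : ℝ)..Real.pi, a s * Complex.exp (Complex.I * (t * Real.sin s : ℝ))‖
      ≤ 2 * (M * (1 + Real.pi + Real.pi ^ 2 / 2)) / √t := by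
  have hac : Continuous a := continuous_iff_continuousAt.2 fun s => (ha s).continuousAt
  have hint : ∀ p q : ℝ, IntervalIntegrable
      (fun s => a s * Complex.exp (Complex.I * (t * Real.sin s : ℝ))) volume p q := fun p q =>
    Continuous.intervalIntegrable (by fun_prop) _ _
  -- The stationary point of `sin` is `π/2`; substituting `π/2 ∓ s` on the two halves moves it to
  -- the endpoint `0`.
  have h1 := norm_integral_mul_exp_cos_le (b := fun s => a (Real.pi / 2 - s))
    (b' := fun s => -a' (Real.pi / 2 - s)) hM ht
    (fun s => by simpa using (ha (Real.pi / 2 - s)).comp_const_sub (Real.pi / 2) s)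
    (by fun_prop) (fun s => haM _) (fun s => by rw [norm_neg]; exact ha'M _)
  have h2 := norm_integral_mul_exp_cos_le (b := fun s => a (Real.pi / 2 + s))
    (b' := fun s => a' (Real.pi / 2 + s)) hM ht
    (fun s => by simpa using (ha (Real.pi / 2 + s)).comp_const_add (Real.pi / 2) s)
    (by fun_prop) (fun s => haM _) (fun s => ha'M _)
  have e1 : (∫ s in (0 : ℝ)..(Real.pi / 2),
      a s * Complex.exp (Complex.I * (t * Real.sin s : ℝ)))
      = ∫ s in (0 : ℝ)..(Real.pi / 2),
        a (Real.pi / 2 - s) * Complex.exp (Complex.I * (t * Real.cos s : ℝ)) := by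
    have := intervalIntegral.integral_comp_sub_left (a := 0) (b := Real.pi / 2)
      (fun s => a s * Complex.exp (Complex.I * (t * Real.sin s : ℝ))) (Real.pi / 2)
    simp only [Real.sin_pi_div_two_sub, sub_self, sub_zero] at this
    exact this.symm
  have e2 : (∫ s in (Real.pi / 2)..Real.pi,
      a s * Complex.exp (Complex.I * (t * Real.sin s : ℝ)))
      = ∫ s in (0 : ℝ)..(Real.pi / 2),
        a (Real.pi / 2 + s) * Complex.exp (Complex.I * (t * Real.cos s : ℝ)) := by
    have := intervalIntegral.integral_comp_add_left (a := 0) (b := Real.pi / 2)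
      (fun s => a s * Complex.exp (Complex.I * (t * Real.sin s : ℝ))) (Real.pi / 2)
    simp only [add_comm (Real.pi / 2), Real.sin_add_pi_div_two, zero_add, add_halves] at this
    simp only [add_comm (Real.pi / 2)]
    exact this.symm
  rw [← intervalIntegral.integral_add_adjacent_intervals (hint 0 (Real.pi / 2)) (hint _ _), e1, e2]
  calc _ ≤ _ := (norm_add_le _ _).trans (add_le_add h1 h2)
    _ = _ := by ring

end VanDerCorput

/-! ### Decay of the Hankel functions and their derivatives -/

section HankelDecay

open MeasureTheory intervalIntegral Set Filter

/-- The oscillatory part `∫_0^π exp (i (t sin τ - n τ)) dτ` of `π H⁽¹⁾_n(t)`. -/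
noncomputable def hankelOsc (n : ℤ) (t : ℝ) : ℂ :=
  ∫ τ in (0 : ℝ)..Real.pi, Complex.exp (-(Complex.I * n * τ)) *
    Complex.exp (Complex.I * (t * Real.sin τ : ℝ))

/-- The amplitude of the exponentially damped part of `H⁽¹⁾_n`. -/
noncomputable def dampAmp (n : ℤ) (u : ℝ) : ℝ :=
  Real.exp (n * u) + (-1 : ℝ) ^ n * Real.exp (-(n * u))

/-- The exponentially damped part of `Y_n`. -/
noncomputable def hankelDamp (n : ℤ) (t : ℝ) : ℝ :=
  ∫ u in Ioi (0 : ℝ), dampAmp n u * Real.exp (-(t * Real.sinh u))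

theorem hankel_eq (n : ℤ) (t : ℝ) :
    hankel n t = (1 / Real.pi : ℝ) * hankelOsc n t
      - Complex.I * (1 / Real.pi : ℝ) * (hankelDamp n t : ℂ) := by
  have h : hankelOsc n t = ((∫ τ in (0 : ℝ)..Real.pi, Real.cos (n * τ - t * Real.sin τ) : ℝ) : ℂ)
      + Complex.I * ((∫ τ in (0 : ℝ)..Real.pi, Real.sin (t * Real.sin τ - n * τ) : ℝ) : ℂ) := by
    rw [← intervalIntegral.integral_ofReal, ← intervalIntegral.integral_ofReal,
      ← intervalIntegral.integral_const_mul, ← intervalIntegral.integral_add]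
    · refine intervalIntegral.integral_congr fun τ _ => ?_
      rw [← Complex.exp_add, ← neg_sub (t * Real.sin τ), Real.cos_neg, Complex.ofReal_cos,
        Complex.ofReal_sin, mul_comm Complex.I (Complex.sin _), ← Complex.exp_mul_I]
      congr 1
      push_cast
      ring
    · exact Continuous.intervalIntegrable (by fun_prop) _ _
    · exact Continuous.intervalIntegrable (by fun_prop) _ _
  rw [h, hankel, besselJ, besselY]
  simp only [hankelDamp, dampAmp]
  push_cast
  ring

theorem norm_exp_neg_I_mul (n : ℤ) (τ : ℝ) : ‖Complex.exp (-(Complex.I * n * τ))‖ = 1 := by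
  rw [show -(Complex.I * n * τ : ℂ) = ((-(n * τ) : ℝ) : ℂ) * Complex.I by push_cast; ring]
  exact Complex.norm_exp_ofReal_mul_I _

/-- The derivative only inserts the smooth factor `i sin τ` into the amplitude, leaving an integral
of van der Corput type. -/
theorem hasDerivAt_hankelOsc (n : ℤ) (t : ℝ) :
    HasDerivAt (hankelOsc n)
      (∫ τ in (0 : ℝ)..Real.pi, (Complex.exp (-(Complex.I * n * τ)) * (Complex.I * Real.sin τ)) *
        Complex.exp (Complex.I * (t * Real.sin τ : ℝ))) t := by
  have h := intervalIntegral.hasDerivAt_integral_of_dominated_loc_of_deriv_le (𝕜 := ℝ)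
    (μ := volume) (a := 0) (b := Real.pi) (bound := fun _ => 1) (x₀ := t)
    (s := univ) (F := fun t τ => Complex.exp (-(Complex.I * n * τ)) *
      Complex.exp (Complex.I * (t * Real.sin τ : ℝ)))
    (F' := fun t τ => (Complex.exp (-(Complex.I * n * τ)) * (Complex.I * Real.sin τ)) *
        Complex.exp (Complex.I * (t * Real.sin τ : ℝ)))
    univ_mem
    (Eventually.of_forall fun x => Continuous.aestronglyMeasurable (by fun_prop))
    (Continuous.intervalIntegrable (by fun_prop) _ _)
    (Continuous.aestronglyMeasurable (by fun_prop))
    (Eventually.of_forall fun τ _ x _ => ?_)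
    (by simp)
    (Eventually.of_forall fun τ _ x _ => ?_)
  · exact h.2
  · have h2 : ‖Complex.exp (Complex.I * (x * Real.sin τ : ℝ))‖ = 1 := by
      rw [mul_comm]; exact Complex.norm_exp_ofReal_mul_I _
    rw [norm_mul, norm_mul, norm_mul, norm_exp_neg_I_mul, h2, Complex.norm_I, Complex.norm_real]
    simpa using Real.abs_sin_le_one τ
  · have := ((((hasDerivAt_id x).mul_const (Real.sin τ)).ofReal_comp.const_mul
      Complex.I).cexp).const_mul (Complex.exp (-(Complex.I * n * τ)))
    refine this.congr_deriv ?_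
    simp only [id]
    push_cast
    ring

theorem hasDerivAt_exp_neg_I_mul (n : ℤ) (τ : ℝ) :
    HasDerivAt (fun τ : ℝ => Complex.exp (-(Complex.I * n * τ)))
      (Complex.exp (-(Complex.I * n * τ)) * -(Complex.I * n)) τ := by
  have := (((hasDerivAt_id τ).ofReal_comp.const_mul (Complex.I * n)).neg).cexp
  simpa using this

theorem exists_hankelOsc_bound (n : ℤ) :
    ∃ C : ℝ, 0 ≤ C ∧ ∀ t, 1 ≤ t → ‖hankelOsc n t‖ ≤ C / √t ∧ ‖deriv (hankelOsc n) t‖ ≤ C / √t := by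
  -- `1 + |n|` bounds both amplitudes, `exp (-inτ)` and `i sin τ exp (-inτ)`, together with their
  -- `τ`-derivatives.
  have hM : (0 : ℝ) ≤ 1 + |(n : ℝ)| := by positivity
  refine ⟨2 * ((1 + |(n : ℝ)|) * (1 + Real.pi + Real.pi ^ 2 / 2)), by positivity, fun t ht => ⟨?_, ?_⟩⟩
  · refine norm_integral_mul_exp_sin_le hM ht (hasDerivAt_exp_neg_I_mul n) (by fun_prop)
      (fun s => ?_) (fun s => ?_)
    · rw [norm_exp_neg_I_mul]; linarith [abs_nonneg (n : ℝ)]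
    · rw [norm_mul, norm_exp_neg_I_mul, norm_neg, norm_mul, Complex.norm_I, Complex.norm_intCast]
      linarith
  · rw [(hasDerivAt_hankelOsc n t).deriv]
    refine norm_integral_mul_exp_sin_le hM ht
      (fun s => (hasDerivAt_exp_neg_I_mul n s).mul
        ((Real.hasDerivAt_sin s).ofReal_comp.const_mul Complex.I)) (by fun_prop)
      (fun s => ?_) (fun s => ?_)
    · rw [norm_mul, norm_exp_neg_I_mul, norm_mul, Complex.norm_I, Complex.norm_real, one_mul,
        one_mul]
      linarith [abs_nonneg (n : ℝ), Real.abs_sin_le_one s, Real.norm_eq_abs (Real.sin s)]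
    · refine (norm_add_le _ _).trans ?_
      simp only [norm_mul, norm_exp_neg_I_mul, norm_neg, Complex.norm_I, Complex.norm_real,
        Complex.norm_intCast, one_mul, Real.norm_eq_abs]
      nlinarith [abs_nonneg (n : ℝ), Real.abs_sin_le_one s, Real.abs_cos_le_one s]

theorem continuous_dampAmp (n : ℤ) : Continuous (dampAmp n) := by
  unfold dampAmp; fun_prop

theorem abs_dampAmp_le (n : ℤ) {u : ℝ} (hu : 0 ≤ u) :
    |dampAmp n u| ≤ 2 * Real.exp (n.natAbs * u) := by
  have hn : ((n.natAbs : ℕ) : ℝ) = |(n : ℝ)| := by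
    rw [← Int.cast_natCast, Int.natCast_natAbs, Int.cast_abs]
  have h1 : Real.exp (n * u) ≤ Real.exp (n.natAbs * u) := by
    rw [hn]; gcongr; exact le_abs_self _
  have h2 : Real.exp (-(n * u)) ≤ Real.exp (n.natAbs * u) := by
    rw [hn, ← neg_mul]; gcongr; exact neg_le_abs _
  have h3 : |(-1 : ℝ) ^ n| = 1 := by rw [abs_zpow]; simp
  calc |dampAmp n u| ≤ |Real.exp (n * u)| + |(-1 : ℝ) ^ n * Real.exp (-(n * u))| := abs_add_le _ _
    _ = Real.exp (n * u) + Real.exp (-(n * u)) := by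
      rw [abs_mul, h3, one_mul, Real.abs_exp, Real.abs_exp]
    _ ≤ _ := by linarith

/-- With `y = sinh u`, `exp u ≤ 1 + 2y` makes the amplitude at most polynomial in `y`. A factor `exp
(y/2)` absorbs the polynomial, and `y ≥ u`, `t ≥ 1` leave `exp (-tu/2)`. The factor `1 + sinh u`
covers the integrand and its `t`-derivative at once. -/
theorem exists_damp_bound (n : ℤ) :
    ∃ C : ℝ, 0 ≤ C ∧ ∀ u, 0 ≤ u → ∀ t, 1 ≤ t →
      |dampAmp n u| * (1 + Real.sinh u) * Real.exp (-(t * Real.sinh u))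
        ≤ C * Real.exp (-(t / 2) * u) := by
  set m := n.natAbs with hm
  refine ⟨2 * (4 ^ (m + 1) * (m + 1).factorial * Real.exp (1 / 4)), by positivity,
    fun u hu t ht => ?_⟩
  set y := Real.sinh u with hy
  have huy : u ≤ y := Real.self_le_sinh_iff.2 hu
  have hy0 : 0 ≤ y := hu.trans huy
  have h1 : Real.exp u ≤ 1 + 2 * y := by
    have : Real.exp (-u) ≤ 1 := Real.exp_le_one_iff.2 (by linarith)
    rw [hy, Real.sinh_eq]; linarith
  have h2 : Real.exp (m * u) ≤ (1 + 2 * y) ^ m := by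
    rw [Real.exp_nat_mul]; gcongr
  have h3 : (1 + 2 * y) ^ (m + 1) ≤ 4 ^ (m + 1) * (m + 1).factorial * Real.exp (1 / 4)
      * Real.exp (y / 2) := by
    have := Real.pow_div_factorial_le_exp ((1 + 2 * y) / 4) (by positivity) (m + 1)
    rw [div_le_iff₀ (by positivity), div_pow, div_le_iff₀ (by positivity)] at this
    refine this.trans (le_of_eq ?_)
    rw [show (1 + 2 * y) / 4 = 1 / 4 + y / 2 by ring, Real.exp_add]
    ring
  have h4 : Real.exp (y / 2) * Real.exp (-(t * y)) ≤ Real.exp (-(t / 2) * u) := by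
    rw [← Real.exp_add]
    apply Real.exp_le_exp.2
    nlinarith
  calc |dampAmp n u| * (1 + y) * Real.exp (-(t * y))
      ≤ 2 * (1 + 2 * y) ^ m * (1 + 2 * y) * Real.exp (-(t * y)) := by
        gcongr
        · exact (abs_dampAmp_le n hu).trans (by linarith)
        · linarith
    _ = 2 * (1 + 2 * y) ^ (m + 1) * Real.exp (-(t * y)) := by ring
    _ ≤ 2 * (4 ^ (m + 1) * (m + 1).factorial * Real.exp (1 / 4) * Real.exp (y / 2))
          * Real.exp (-(t * y)) := by gcongr
    _ = 2 * (4 ^ (m + 1) * (m + 1).factorial * Real.exp (1 / 4))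
          * (Real.exp (y / 2) * Real.exp (-(t * y))) := by ring
    _ ≤ _ := by gcongr

theorem integrableOn_exp_half {t : ℝ} (ht : 0 < t) (C : ℝ) :
    IntegrableOn (fun u => C * Real.exp (-(t / 2) * u)) (Ioi 0) :=
  (integrableOn_exp_mul_Ioi (by linarith) 0).const_mul C

theorem abs_integral_le_of_damped {f : ℝ → ℝ} {C t : ℝ} (ht : 0 < t)
    (hf : ∀ u, 0 ≤ u → |f u| ≤ C * Real.exp (-(t / 2) * u)) :
    |∫ u in Ioi (0 : ℝ), f u| ≤ 2 * C / t := by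
  have h := MeasureTheory.norm_integral_le_of_norm_le (μ := volume.restrict (Ioi 0)) (f := f)
    (integrableOn_exp_half ht C)
    ((ae_restrict_iff' measurableSet_Ioi).2 (Eventually.of_forall fun u hu => hf u (le_of_lt hu)))
  rw [Real.norm_eq_abs] at h
  refine h.trans (le_of_eq ?_)
  rw [MeasureTheory.integral_const_mul, integral_exp_mul_Ioi (by linarith)]
  simp
  field_simp

theorem hasDerivAt_hankelDamp (n : ℤ) {t : ℝ} (ht : 1 < t) :
    HasDerivAt (hankelDamp n)
      (∫ u in Ioi (0 : ℝ), dampAmp n u * (-Real.sinh u * Real.exp (-(t * Real.sinh u)))) t := by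
  obtain ⟨C, hC, hb⟩ := exists_damp_bound n
  have hamp := continuous_dampAmp n
  have hmeas : ∀ x : ℝ, AEStronglyMeasurable
      (fun u => dampAmp n u * Real.exp (-(x * Real.sinh u))) (volume.restrict (Ioi 0)) :=
    fun x => Continuous.aestronglyMeasurable
      (hamp.mul (Real.continuous_exp.comp (continuous_const.mul Real.continuous_sinh).neg))
  -- On the neighbourhood `t > 1` the damping is at least that at `t = 1`, which gives a dominating
  -- function independent of `t`.
  have h := hasDerivAt_integral_of_dominated_loc_of_deriv_le (𝕜 := ℝ)
    (μ := volume.restrict (Ioi (0 : ℝ))) (bound := fun u => C * Real.exp (-(1 / 2) * u)) (x₀ := t)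
    (s := Ioi 1) (F := fun t u => dampAmp n u * Real.exp (-(t * Real.sinh u)))
    (F' := fun t u => dampAmp n u * (-Real.sinh u * Real.exp (-(t * Real.sinh u))))
    (Ioi_mem_nhds ht)
    (Eventually.of_forall hmeas)
    (Integrable.mono' (integrableOn_exp_half one_pos C) (hmeas t)
      ((ae_restrict_iff' measurableSet_Ioi).2 (Eventually.of_forall fun u hu => ?_)))
    (Continuous.aestronglyMeasurable (hamp.mul (Real.continuous_sinh.neg.mul
      (Real.continuous_exp.comp (continuous_const.mul Real.continuous_sinh).neg))))
    ((ae_restrict_iff' measurableSet_Ioi).2 (Eventually.of_forall fun u hu x hx => ?_))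
    (integrableOn_exp_half one_pos C)
    (Eventually.of_forall fun u x _ => ?_)
  · exact h.2
  · have hu' : 0 < u := hu
    have hs := Real.sinh_nonneg_iff.2 hu'.le
    rw [Real.norm_eq_abs, abs_mul, Real.abs_exp]
    refine le_trans ?_ ((hb u hu'.le t ht.le).trans ?_)
    · gcongr
      nlinarith [abs_nonneg (dampAmp n u)]
    · gcongr
  · have hu' : 0 < u := hu
    have hx' : 1 < x := hx
    have hs := Real.sinh_nonneg_iff.2 hu'.le
    rw [Real.norm_eq_abs, abs_mul, abs_mul, Real.abs_exp, abs_neg, abs_of_nonneg hs, ← mul_assoc]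
    refine le_trans ?_ ((hb u hu'.le x hx'.le).trans ?_)
    · gcongr
      linarith
    · gcongr
  · have := (((hasDerivAt_id x).mul_const (Real.sinh u)).neg.exp).const_mul (dampAmp n u)
    refine this.congr_deriv ?_
    simp only [id, Pi.neg_apply]
    ring

theorem exists_hankelDamp_bound (n : ℤ) :
    ∃ C : ℝ, 0 ≤ C ∧ ∀ t, 1 < t → |hankelDamp n t| ≤ C / t ∧ |deriv (hankelDamp n) t| ≤ C / t := by
  obtain ⟨C, hC, hb⟩ := exists_damp_bound n
  refine ⟨2 * C, by positivity, fun t ht => ⟨?_, ?_⟩⟩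
  · refine abs_integral_le_of_damped (by linarith) fun u hu => ?_
    have hs := Real.sinh_nonneg_iff.2 hu
    rw [abs_mul, Real.abs_exp]
    refine le_trans ?_ (hb u hu t ht.le)
    gcongr
    nlinarith [abs_nonneg (dampAmp n u)]
  · rw [(hasDerivAt_hankelDamp n ht).deriv]
    refine abs_integral_le_of_damped (by linarith) fun u hu => ?_
    have hs := Real.sinh_nonneg_iff.2 hu
    rw [abs_mul, abs_mul, Real.abs_exp, abs_neg, abs_of_nonneg hs, ← mul_assoc]
    refine le_trans ?_ (hb u hu t ht.le)
    gcongr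
    linarith

theorem hasDerivAt_hankel (n : ℤ) {t : ℝ} (ht : 1 < t) :
    HasDerivAt (hankel n) ((1 / Real.pi : ℝ) * deriv (hankelOsc n) t
      - Complex.I * (1 / Real.pi : ℝ) * ((deriv (hankelDamp n) t : ℝ) : ℂ)) t := by
  rw [show hankel n = fun t => (1 / Real.pi : ℝ) * hankelOsc n t
      - Complex.I * (1 / Real.pi : ℝ) * (hankelDamp n t : ℂ) from funext (hankel_eq n)]
  exact ((hasDerivAt_hankelOsc n t).differentiableAt.hasDerivAt.const_mul _).sub
    ((hasDerivAt_hankelDamp n ht).differentiableAt.hasDerivAt.ofReal_comp.const_mul _)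

/-- `H⁽¹⁾_n` and its derivative decay like `t ^ (-1/2)`. -/
theorem exists_hankel_bound (n : ℤ) :
    ∃ C : ℝ, 0 ≤ C ∧ ∀ t, 1 < t → ‖hankel n t‖ ≤ C / √t ∧ ‖deriv (hankel n) t‖ ≤ C / √t := by
  obtain ⟨C₁, hC₁, h₁⟩ := exists_hankelOsc_bound n
  obtain ⟨C₂, hC₂, h₂⟩ := exists_hankelDamp_bound n
  refine ⟨C₁ + C₂, by positivity, fun t ht => ?_⟩
  -- The function and its derivative are the same combination of an oscillatory and a damped part;
  -- `√t ≤ t` weakens `1/t` to `1/√t`.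
  have key : ∀ (a : ℂ) (b : ℝ), ‖a‖ ≤ C₁ / √t → |b| ≤ C₂ / t →
      ‖((1 / Real.pi : ℝ) : ℂ) * a - Complex.I * ((1 / Real.pi : ℝ) : ℂ) * (b : ℂ)‖
        ≤ (C₁ + C₂) / √t := fun a b ha hb => by
    have hpi : |1 / Real.pi| ≤ 1 := by
      rw [abs_of_pos (by positivity), div_le_one Real.pi_pos]
      linarith [Real.pi_gt_three]
    have hst : √t ≤ t := Real.sqrt_le_iff.2 ⟨by linarith, by nlinarith⟩
    have hst0 : 0 < √t := Real.sqrt_pos.2 (by linarith)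
    refine (norm_sub_le _ _).trans ?_
    rw [norm_mul, norm_mul, norm_mul, Complex.norm_I, Complex.norm_real, Complex.norm_real,
      Real.norm_eq_abs, Real.norm_eq_abs, one_mul, add_div]
    refine add_le_add ?_ ?_
    · calc _ ≤ 1 * ‖a‖ := by gcongr
        _ ≤ _ := by rw [one_mul]; exact ha
    · calc _ ≤ 1 * |b| := by gcongr
        _ ≤ C₂ / t := by rw [one_mul]; exact hb
        _ ≤ _ := by gcongr
  refine ⟨?_, ?_⟩
  · rw [hankel_eq]; exact key _ _ (h₁ t ht.le).1 (h₂ t ht).1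
  · rw [(hasDerivAt_hankel n ht).deriv]; exact key _ _ (h₁ t ht.le).2 (h₂ t ht).2

end HankelDecay

/-! ### Discrete orthogonality and independence of the directions -/

/-- Orthogonality of the characters `r ↦ exp (i k θ_r)` for frequencies below the sampling rate. -/
theorem sum_exp_angle {N : ℕ} {k : ℤ} (hk : |k| < N) :
    ∑ r : Fin N, Complex.exp (Complex.I * k * ((2 * Real.pi * ((r : ℝ) + 1) / N : ℝ) : ℂ))
      = if k = 0 then (N : ℂ) else 0 := by
  split_ifs with h
  · simp [h]
  have hN : (N : ℂ) ≠ 0 := by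
    have : (0 : ℤ) < N := (abs_nonneg k).trans_lt hk
    exact_mod_cast this.ne'
  set ζ : ℂ := Complex.exp (2 * Real.pi * Complex.I * (k / N)) with hζ
  have hζN : ζ ^ N = 1 := by
    rw [hζ, ← Complex.exp_nat_mul, Complex.exp_eq_one_iff]
    exact ⟨k, by field_simp⟩
  have hζ1 : ζ ≠ 1 := by
    intro h1
    obtain ⟨l, hl⟩ := Complex.exp_eq_one_iff.1 h1
    have h2 : (k : ℂ) / N = l := by
      have : (2 * Real.pi * Complex.I : ℂ) ≠ 0 := Complex.two_pi_I_ne_zero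
      apply mul_left_cancel₀ this
      rw [hl]; ring
    rw [div_eq_iff hN] at h2
    have h3 : k = l * N := by exact_mod_cast h2
    exact h (Int.eq_zero_of_abs_lt_dvd (m := N) ⟨l, by rw [h3]; ring⟩ hk)
  -- Numbering the receivers from `1` costs only a constant factor `ζ` in front of the geometric
  -- sum.
  have : ∀ r : Fin N, Complex.exp (Complex.I * k * ((2 * Real.pi * ((r : ℝ) + 1) / N : ℝ) : ℂ))
      = ζ * ζ ^ (r : ℕ) := fun r => by
    rw [hζ, ← Complex.exp_nat_mul, ← Complex.exp_add]
    congr 1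
    push_cast
    field_simp
    ring
  simp_rw [this]
  rw [← Finset.mul_sum, Fin.sum_univ_eq_sum_range (fun i => ζ ^ i), geom_sum_eq hζ1, hζN]
  simp

/-- The directions `d`, `e` form an orthonormal basis, so the components along them determine the
bilinear product of two complex vectors. -/
theorem sum_components_mul {d e : Plane} (hd : ‖d‖ = 1) (he : ‖e‖ = 1) (hde : inner ℝ d e = 0)
    (a b : Fin 2 → ℂ) :
    (∑ i, a i * ((d i : ℝ) : ℂ)) * (∑ i, b i * ((d i : ℝ) : ℂ))
      + (∑ i, a i * ((e i : ℝ) : ℂ)) * (∑ i, b i * ((e i : ℝ) : ℂ)) = ∑ i, a i * b i := by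
  have h1 : d 0 ^ 2 + d 1 ^ 2 = 1 := by
    have := EuclideanSpace.real_norm_sq_eq d
    rw [hd, Fin.sum_univ_two] at this; linarith
  have h2 : e 0 ^ 2 + e 1 ^ 2 = 1 := by
    have := EuclideanSpace.real_norm_sq_eq e
    rw [he, Fin.sum_univ_two] at this; linarith
  have h3 : d 0 * e 0 + d 1 * e 1 = 0 := by
    rw [PiLp.inner_apply, Fin.sum_univ_two] at hde
    simp only [RCLike.inner_apply, conj_trivial] at hde
    linarith
  have hM : !![d 0, d 1; e 0, e 1] * !![d 0, e 0; d 1, e 1] = 1 := by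
    rw [Matrix.one_fin_two]
    ext i j
    fin_cases i <;> fin_cases j <;> simp [Matrix.mul_apply] <;> linarith
  -- Orthonormal rows of a square matrix force orthonormal columns.
  have hM' := mul_eq_one_comm.1 hM
  have k1 : d 0 * d 0 + e 0 * e 0 = 1 := by simpa [Matrix.mul_apply] using congrFun (congrFun hM' 0) 0
  have k2 : d 1 * d 1 + e 1 * e 1 = 1 := by simpa [Matrix.mul_apply] using congrFun (congrFun hM' 1) 1
  have k3 : d 0 * d 1 + e 0 * e 1 = 0 := by simpa [Matrix.mul_apply] using congrFun (congrFun hM' 0) 1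
  have k1' : (d 0 : ℂ) * d 0 + e 0 * e 0 = 1 := by
    have := congrArg (fun r : ℝ => (r : ℂ)) k1
    push_cast at this; exact this
  have k2' : (d 1 : ℂ) * d 1 + e 1 * e 1 = 1 := by
    have := congrArg (fun r : ℝ => (r : ℂ)) k2
    push_cast at this; exact this
  have k3' : (d 0 : ℂ) * d 1 + e 0 * e 1 = 0 := by
    have := congrArg (fun r : ℝ => (r : ℂ)) k3
    push_cast at this; exact this
  simp only [Fin.sum_univ_two]
  linear_combination a 0 * b 0 * k1' + a 1 * b 1 * k2' + (a 0 * b 1 + a 1 * b 0) * k3'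

/-! ### Polar form of the cylindrical eigenvectors -/

/-- This removes the branch cut of `arg`: the integer power of `z/|z|` is differentiable at every
nonzero point. -/
theorem exp_polarAngle (m : ℤ) {x : Plane} (hx : x ≠ 0) :
    Complex.exp (Complex.I * (m : ℂ) * (polarAngle x : ℂ))
      = (((x 0 : ℂ) + x 1 * Complex.I) / (‖x‖ : ℂ)) ^ m := by
  have hz : (⟨x 0, x 1⟩ : ℂ) = (x 0 : ℂ) + x 1 * Complex.I := Complex.mk_eq_add_mul_I _ _
  have hn : ‖(⟨x 0, x 1⟩ : ℂ)‖ = ‖x‖ := by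
    rw [EuclideanSpace.norm_eq, Fin.sum_univ_two, Complex.norm_def, Complex.normSq_mk]
    simp [sq]
  have h := Complex.norm_mul_exp_arg_mul_I ⟨x 0, x 1⟩
  have hx' : (‖x‖ : ℂ) ≠ 0 := by exact_mod_cast norm_ne_zero_iff.2 hx
  rw [hn] at h
  have h' := eq_div_of_mul_eq hx' ((mul_comm _ _).trans h)
  rw [← hz, ← h', ← Complex.exp_int_mul]
  congr 1
  simp only [polarAngle]
  ring

theorem norm_polar {R θ : ℝ} (hR : 0 < R) :
    ‖(!₂[R * Real.cos θ, R * Real.sin θ] : Plane)‖ = R := by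
  rw [EuclideanSpace.norm_eq, Fin.sum_univ_two]
  simp only [Matrix.cons_val_zero, Matrix.cons_val_one, Real.norm_eq_abs, sq_abs]
  rw [show (R * Real.cos θ) ^ 2 + (R * Real.sin θ) ^ 2
    = R ^ 2 * (Real.sin θ ^ 2 + Real.cos θ ^ 2) by ring, Real.sin_sq_add_cos_sq, mul_one,
    Real.sqrt_sq hR.le]

/-- The polar form of the differential of `v_m`. -/
theorem fderiv_waveV_apply (m : ℤ) {κ R θ : ℝ} (hR : 0 < R)
    (hd : DifferentiableAt ℝ (hankel m) (κ * R)) (v : Plane) :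
    fderiv ℝ (waveV m κ) !₂[R * Real.cos θ, R * Real.sin θ] v
      = Complex.exp (Complex.I * m * θ) *
        (κ * deriv (hankel m) (κ * R) * (Real.cos θ * v 0 + Real.sin θ * v 1 : ℝ)
          + Complex.I * m / R * hankel m (κ * R) * (-Real.sin θ * v 0 + Real.cos θ * v 1 : ℝ)) := by
  set x : Plane := !₂[R * Real.cos θ, R * Real.sin θ] with hxdef
  have hnx : ‖x‖ = R := norm_polar hR
  have hx : x ≠ 0 := norm_ne_zero_iff.1 (by rw [hnx]; exact hR.ne')
  have hx0 : x 0 = R * Real.cos θ := rfl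
  have hx1 : x 1 = R * Real.sin θ := rfl
  have hR' : (R : ℂ) ≠ 0 := by exact_mod_cast hR.ne'
  have hline : HasDerivAt (fun s : ℝ => x + s • v) v 0 := by
    simpa using ((hasDerivAt_id (0 : ℝ)).smul_const v).const_add x
  set f : Plane → ℂ := fun y => hankel m (κ * ‖y‖) * (((y 0 : ℂ) + y 1 * Complex.I) / (‖y‖ : ℂ)) ^ m
    with hf
  have heq : waveV m κ =ᶠ[nhds x] f := by
    filter_upwards [isOpen_ne.mem_nhds hx] with y hy
    simp only [hf, waveV]
    rw [exp_polarAngle m hy]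
  have hnd : DifferentiableAt ℝ (fun y : Plane => ‖y‖) x := differentiableAt_id.norm ℝ hx
  have hwx : ((x 0 : ℂ) + x 1 * Complex.I) / (‖x‖ : ℂ) = Complex.exp (Complex.I * θ) := by
    rw [hnx, hx0, hx1, mul_comm Complex.I, Complex.exp_mul_I]
    push_cast; field_simp
  have hw0 : ((x 0 : ℂ) + x 1 * Complex.I) / (‖x‖ : ℂ) ≠ 0 := by
    rw [hwx]; exact Complex.exp_ne_zero _
  have hfd : DifferentiableAt ℝ f x := by
    have h1 : DifferentiableAt ℝ (fun y : Plane => hankel m (κ * ‖y‖)) x :=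
      DifferentiableAt.comp x (g := hankel m) (by rw [hnx]; exact hd) (hnd.const_mul κ)
    have h2 : DifferentiableAt ℝ (fun y : Plane => (‖y‖ : ℂ)) x :=
      Complex.ofRealCLM.differentiableAt.comp x hnd
    have hc : ∀ i, DifferentiableAt ℝ (fun y : Plane => ((y i : ℝ) : ℂ)) x := fun i =>
      Complex.ofRealCLM.differentiableAt.comp x (by fun_prop)
    have hn0 : (‖x‖ : ℂ) ≠ 0 := by rw [hnx]; exact hR'
    have h3 : DifferentiableAt ℝ
        (fun y : Plane => ((y 0 : ℂ) + y 1 * Complex.I) / (‖y‖ : ℂ)) x := by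
      simp only [div_eq_mul_inv]
      exact ((hc 0).add ((hc 1).mul_const _)).mul (h2.fun_inv hn0)
    have h4 : DifferentiableAt ℝ (fun w : ℂ => w ^ m) (((x 0 : ℂ) + x 1 * Complex.I) / (‖x‖ : ℂ)) :=
      (hasDerivAt_zpow m _ (Or.inl hw0)).differentiableAt.restrictScalars ℝ
    exact h1.mul (DifferentiableAt.comp x (g := fun w : ℂ => w ^ m) h4 h3)
  rw [heq.fderiv_eq]
  -- Once differentiability is known, the differential is found by one-variable calculus along the
  -- line `x + s v`.
  have hderiv := HasFDerivAt.comp_hasDerivAt (0 : ℝ) (f := fun s : ℝ => x + s • v) (l := f)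
    (l' := fderiv ℝ f x) (by simpa using hfd.hasFDerivAt) hline
  refine hderiv.unique ?_
  have hn : HasDerivAt (fun s : ℝ => ‖x + s • v‖) (Real.cos θ * v 0 + Real.sin θ * v 1) 0 := by
    have h1 : HasDerivAt (fun s : ℝ => ‖x + s • v‖ ^ 2) (2 * inner ℝ (x + (0 : ℝ) • v) v) 0 :=
      hline.norm_sq
    have h2 := h1.sqrt (by simp [hx])
    simp only [Real.sqrt_sq (norm_nonneg _)] at h2
    refine h2.congr_deriv ?_
    rw [zero_smul, add_zero, hnx, PiLp.inner_apply, Fin.sum_univ_two, hx0, hx1]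
    simp only [RCLike.inner_apply, conj_trivial]
    field_simp
  have hH : HasDerivAt (fun s : ℝ => hankel m (κ * ‖x + s • v‖))
      ((κ * (Real.cos θ * v 0 + Real.sin θ * v 1)) • deriv (hankel m) (κ * R)) 0 :=
    HasDerivAt.scomp (0 : ℝ) (g₁ := hankel m) (by simpa [hnx] using hd.hasDerivAt)
      (hn.const_mul κ)
  have hco : ∀ i, HasDerivAt (fun s : ℝ => (((x + s • v) i : ℝ) : ℂ)) ((v i : ℝ) : ℂ) 0 := fun i => by
    have : HasDerivAt (fun s : ℝ => x i + s * v i) (v i) 0 := by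
      simpa using ((hasDerivAt_id (0 : ℝ)).mul_const (v i)).const_add (x i)
    simpa using this.ofReal_comp
  have hw := (((hco 0).add ((hco 1).mul_const Complex.I)).div hn.ofReal_comp
    (by simpa [hnx] using hR'))
  have hz := (hasDerivAt_zpow m _ (Or.inl (by simpa using hw0))).scomp (0 : ℝ) hw
  have := hH.mul hz
  refine this.congr_deriv ?_
  simp only [Function.comp, zero_smul, add_zero, Pi.add_apply, Pi.div_apply, hnx]
  rw [hnx] at hwx
  simp only [hwx]
  have e1 : Complex.exp (Complex.I * θ) ^ m = Complex.exp (Complex.I * m * θ) := by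
    rw [← Complex.exp_int_mul]; congr 1; ring
  have e2 : Complex.exp (Complex.I * θ) ^ (m - 1) * Complex.exp (Complex.I * θ)
      = Complex.exp (Complex.I * m * θ) := by
    rw [← zpow_add_one₀ (Complex.exp_ne_zero _), sub_add_cancel, e1]
  -- Numerator of the quotient rule for `z/|z|`: the radial part of `v` cancels and only the
  -- tangential part rotates the phase.
  have e3 : ((v 0 : ℂ) + v 1 * Complex.I) * R - ((x 0 : ℂ) + x 1 * Complex.I)
      * (Real.cos θ * v 0 + Real.sin θ * v 1 : ℝ)
      = R * (Complex.exp (Complex.I * θ) * Complex.I * (-Real.sin θ * v 0 + Real.cos θ * v 1 : ℝ)) := by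
    have hcs : (Real.sin θ : ℂ) ^ 2 + (Real.cos θ : ℂ) ^ 2 = 1 := by
      exact_mod_cast Real.sin_sq_add_cos_sq θ
    rw [hx0, hx1, mul_comm Complex.I, Complex.exp_mul_I, ← Complex.ofReal_cos, ← Complex.ofReal_sin]
    push_cast at hcs ⊢
    linear_combination (-R * (v 0 : ℂ) - R * v 1 * Complex.I) * hcs + (R * (Complex.sin θ)
      * (Complex.sin θ * v 0 - Complex.cos θ * v 1)) * Complex.I_sq
  simp only [smul_eq_mul, Complex.real_smul]
  rw [e1, e3, ← e2]
  push_cast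
  field_simp

/-- The sampling angle `θ_r`. -/
noncomputable def angle (N : ℕ) (r : Fin N) : ℝ := 2 * Real.pi * ((r : ℝ) + 1) / N

/-- The polar form of the cylindrical eigenvectors at the receivers. -/
theorem cylH_receiver (κ : WaveMode → ℝ) (α : WaveMode) (m : ℤ) {N : ℕ} {R : ℝ} (hR : 0 < R)
    (h : ∀ α, 1 < κ α * R) (r : Fin N) :
    cylH κ α m (receiver N R r) =
      ![Complex.exp (Complex.I * m * angle N r) * (coeffG κ R α m * Real.cos (angle N r)
          - coeffH κ R α m * Real.sin (angle N r)),
        Complex.exp (Complex.I * m * angle N r) * (coeffG κ R α m * Real.sin (angle N r)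
          + coeffH κ R α m * Real.cos (angle N r))] := by
  have hx : receiver N R r = !₂[R * Real.cos (angle N r), R * Real.sin (angle N r)] := rfl
  have hf := fun α => fderiv_waveV_apply m (θ := angle N r) hR
    (hasDerivAt_hankel m (h α)).differentiableAt
  rw [hx]
  -- The curl is the gradient turned by `-90°`: the tangential derivative becomes the radial
  -- component, and the radial derivative becomes minus the tangential one.
  cases α <;>
  · simp only [cylH, grad, curl, partialDeriv, hf, coeffG, coeffH]
    ext i
    fin_cases i <;> simp <;> ring

/-! ### The exact Gram matrix -/

theorem conj_exp_I_mul (m : ℤ) (θ : ℝ) :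
    conj (Complex.exp (Complex.I * m * θ)) = Complex.exp (-(Complex.I * m * θ)) := by
  rw [← Complex.exp_conj]
  simp

theorem sum_cylH_mul_conj (κ : WaveMode → ℝ) (α β : WaveMode) (m m' : ℤ) {N : ℕ} {R : ℝ}
    (hR : 0 < R) (h : ∀ α, 1 < κ α * R) (r : Fin N) :
    ∑ i, cylH κ α m (receiver N R r) i * conj (cylH κ β m' (receiver N R r) i)
      = Complex.exp (Complex.I * ((m - m' : ℤ) : ℂ) * angle N r) *
        (coeffG κ R α m * conj (coeffG κ R β m') + coeffH κ R α m * conj (coeffH κ R β m')) := by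
  have he : Complex.exp (Complex.I * ((m - m' : ℤ) : ℂ) * angle N r)
      = Complex.exp (Complex.I * m * angle N r) * Complex.exp (-(Complex.I * m' * angle N r)) := by
    rw [← Complex.exp_add]; congr 1; push_cast; ring
  have hcs : (Real.sin (angle N r) : ℂ) ^ 2 + (Real.cos (angle N r) : ℂ) ^ 2 = 1 := by
    exact_mod_cast Real.sin_sq_add_cos_sq (angle N r)
  rw [cylH_receiver κ α m hR h, cylH_receiver κ β m' hR h, he, Fin.sum_univ_two]
  simp only [Matrix.cons_val_zero, Matrix.cons_val_one, map_mul, map_add, map_sub,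
    Complex.conj_ofReal, conj_exp_I_mul]
  linear_combination Complex.exp (Complex.I * m * angle N r)
    * Complex.exp (-(Complex.I * m' * angle N r))
    * (coeffG κ R α m * conj (coeffG κ R β m') + coeffH κ R α m * conj (coeffH κ R β m')) * hcs

/-- The Gram matrix of the columns of `Y`. -/
theorem gram_apply (κ : WaveMode → ℝ) {K N : ℕ} (hN : 2 * K + 1 ≤ N) {R : ℝ}
    (hR : 0 < R) (h : ∀ α, 1 < κ α * R) {d e : Fin N → Plane} (hd : ∀ r, ‖d r‖ = 1)
    (he : ∀ r, ‖e r‖ = 1) (hde : ∀ r, inner ℝ (d r) (e r) = 0) (α β : WaveMode)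
    (j j' : Fin (2 * K + 1)) :
    ((matYBlock κ K N R d α)ᴴ * matYBlock κ K N R d β
      + (matYBlock κ K N R e α)ᴴ * matYBlock κ K N R e β) j j'
      = if j = j' then (N : ℂ) * (coeffG κ R α (order K j) * conj (coeffG κ R β (order K j))
          + coeffH κ R α (order K j) * conj (coeffH κ R β (order K j))) else 0 := by
  have hsum : ((matYBlock κ K N R d α)ᴴ * matYBlock κ K N R d β
      + (matYBlock κ K N R e α)ᴴ * matYBlock κ K N R e β) j j'
      = ∑ r, ∑ i, cylH κ α (order K j) (receiver N R r) i
          * conj (cylH κ β (order K j') (receiver N R r) i) := by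
    rw [Matrix.add_apply, Matrix.mul_apply, Matrix.mul_apply, ← Finset.sum_add_distrib]
    refine Finset.sum_congr rfl fun r _ => ?_
    rw [← sum_components_mul (hd r) (he r) (hde r)]
    simp [matYBlock]
  -- The sampling condition `2K + 1 ≤ N` excludes aliasing here.
  have hk : |order K j - order K j'| < N := by
    have := j.2
    have := j'.2
    simp only [order]
    rw [abs_lt]
    constructor <;> omega
  have hiff : order K j - order K j' = 0 ↔ j = j' := by
    rw [Fin.ext_iff]; simp only [order]; omega
  rw [hsum]
  simp_rw [sum_cylH_mul_conj κ α β _ _ hR h]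
  rw [← Finset.sum_mul]
  simp only [angle]
  rw [sum_exp_angle hk]
  simp only [hiff]
  split_ifs with hj
  · rw [hj]
  · rw [zero_mul]

/-! ### Decay of the coefficients and the remainder estimate -/

/-- `g^P` and `h^S` contain the Hankel derivative; `h^P` and `g^S` contain `im/R` times the Hankel
function, hence the extra power of `R`. -/
theorem exists_coeff_bound (κ : WaveMode → ℝ) (hκ : ∀ α, 0 < κ α) (m : ℤ) :
    ∃ C : ℝ, 0 ≤ C ∧ ∀ R, 0 < R → (∀ α, 1 < κ α * R) →
      ‖coeffG κ R .P m‖ ≤ C / √R ∧ ‖coeffH κ R .P m‖ ≤ C / (R * √R) ∧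
      ‖coeffG κ R .S m‖ ≤ C / (R * √R) ∧ ‖coeffH κ R .S m‖ ≤ C / √R := by
  obtain ⟨C, hC, hb⟩ := exists_hankel_bound m
  set D : WaveMode → ℝ := fun α => (κ α + |(m : ℝ)|) * (C / √(κ α)) with hD
  have hD0 : ∀ α, 0 ≤ D α := fun α => by have := hκ α; positivity
  have hDle : ∀ α, D α ≤ D .P + D .S := fun α => by
    cases α <;> linarith [hD0 .P, hD0 .S]
  have hmain : ∀ R, 0 < R → (∀ α, 1 < κ α * R) → ∀ α,
      ‖(κ α : ℂ) * deriv (hankel m) (κ α * R)‖ ≤ (D .P + D .S) / √R ∧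
      ‖Complex.I * (m : ℂ) / (R : ℂ) * hankel m (κ α * R)‖ ≤ (D .P + D .S) / (R * √R) := by
    intro R hR h α
    have hκα := hκ α
    have hq : C / √(κ α * R) = C / √(κ α) / √R := by
      rw [Real.sqrt_mul hκα.le, div_div]
    obtain ⟨h1, h2⟩ := hb _ (h α)
    rw [hq] at h1 h2
    constructor
    · rw [norm_mul, Complex.norm_real, Real.norm_of_nonneg hκα.le]
      calc κ α * ‖deriv (hankel m) (κ α * R)‖ ≤ κ α * (C / √(κ α) / √R) := by gcongr
        _ ≤ (κ α + |(m : ℝ)|) * (C / √(κ α) / √R) := by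
            gcongr; linarith [abs_nonneg (m : ℝ)]
        _ = D α / √R := by rw [hD]; ring
        _ ≤ _ := by gcongr; exact hDle α
    · rw [norm_mul, norm_div, norm_mul, Complex.norm_I, one_mul, Complex.norm_intCast,
        Complex.norm_real, Real.norm_of_nonneg hR.le]
      calc |(m : ℝ)| / R * ‖hankel m (κ α * R)‖ ≤ |(m : ℝ)| / R * (C / √(κ α) / √R) := by gcongr
        _ ≤ (κ α + |(m : ℝ)|) / R * (C / √(κ α) / √R) := by
            gcongr; linarith
        _ = D α / (R * √R) := by rw [hD]; field_simp
        _ ≤ _ := by gcongr; exact hDle α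
  refine ⟨D .P + D .S, add_nonneg (hD0 _) (hD0 _), fun R hR h => ⟨(hmain R hR h .P).1,
    (hmain R hR h .P).2, (hmain R hR h .S).2, ?_⟩⟩
  simp only [coeffH]
  rw [norm_neg]
  exact (hmain R hR h .S).1

theorem exists_uniform_coeff_bound (κ : WaveMode → ℝ) (hκ : ∀ α, 0 < κ α) (K : ℕ) :
    ∃ C : ℝ, 0 ≤ C ∧ ∀ R, 0 < R → (∀ α, 1 < κ α * R) → ∀ j : Fin (2 * K + 1),
      ‖coeffG κ R .P (order K j)‖ ≤ C / √R ∧ ‖coeffH κ R .P (order K j)‖ ≤ C / (R * √R) ∧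
      ‖coeffG κ R .S (order K j)‖ ≤ C / (R * √R) ∧ ‖coeffH κ R .S (order K j)‖ ≤ C / √R := by
  choose C hC hb using fun j : Fin (2 * K + 1) => exists_coeff_bound κ hκ (order K j)
  refine ⟨∑ j, C j, Finset.sum_nonneg fun j _ => hC j, fun R hR h j => ?_⟩
  have hle : C j ≤ ∑ j, C j := Finset.single_le_sum (fun j _ => hC j) (Finset.mem_univ j)
  obtain ⟨h1, h2, h3, h4⟩ := hb j R hR h
  exact ⟨h1.trans (by gcongr), h2.trans (by gcongr), h3.trans (by gcongr), h4.trans (by gcongr)⟩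

end ElasticScattering

theorem lemma4p2 (κ : ElasticScattering.WaveMode → ℝ) (hκ : ∀ α, 0 < κ α)
    (K N : ℕ) (hN : 2 * K + 1 ≤ N) :
    ∃ C > (0 : ℝ), ∃ R₀ > (0 : ℝ), ∀ R : ℝ, R₀ ≤ R →
      ∀ d dPerp : Fin N → ElasticScattering.Plane,
        (∀ r, ‖d r‖ = 1) → (∀ r, ‖dPerp r‖ = 1) → (∀ r, inner ℝ (d r) (dPerp r) = 0) →
        ∃ Q : Matrix (Fin (2 * K + 1) ⊕ Fin (2 * K + 1)) (Fin (2 * K + 1) ⊕ Fin (2 * K + 1)) ℂ,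
          (ElasticScattering.matY κ K N R d dPerp)ᴴ * ElasticScattering.matY κ K N R d dPerp
              = (N : ℂ) • ElasticScattering.matZ κ K R + Q ∧
            ∀ l l', ‖Q l l'‖ ≤ C * R ^ (-2 : ℤ) := by
  open ElasticScattering in
  obtain ⟨C, hC, hb⟩ := exists_uniform_coeff_bound κ hκ K
  have hκP := hκ .P
  have hκS := hκ .S
  -- A mixed entry is a sum of two products, hence the `2`; the `+ 1` keeps the constant positive if
  -- `C = 0`. The threshold ensures `R ≥ 1` and `κ_α R ≥ 2`, inside the range of the Hankel bounds.
  refine ⟨2 * N * C ^ 2 + 1, by positivity, 1 + 2 / κ .P + 2 / κ .S, by positivity,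
    fun R hR d e hd he hde => ?_⟩
  have hp : 0 < 2 / κ .P := by positivity
  have hs : 0 < 2 / κ .S := by positivity
  have hR1 : 1 ≤ R := by linarith
  have hR0 : 0 < R := by linarith
  have h : ∀ α, 1 < κ α * R := fun α => by
    have h1 : 2 / κ α ≤ R := by cases α <;> linarith
    have := (div_le_iff₀' (hκ α)).1 h1
    linarith
  refine ⟨(matY κ K N R d e)ᴴ * matY κ K N R d e - (N : ℂ) • matZ κ K R,
    (add_sub_cancel _ _).symm, ?_⟩
  have hgram := gram_apply κ hN hR0 h hd he hde
  have hsq : √R * √R = R := Real.mul_self_sqrt hR0.le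
  have hst0 : 0 < √R := Real.sqrt_pos.2 hR0
  have hfin : ∀ x : ℝ, x ≤ 2 * N * (C ^ 2 / R ^ 2) → x ≤ (2 * N * C ^ 2 + 1) * R ^ (-2 : ℤ) := by
    intro x hx
    refine hx.trans ?_
    rw [zpow_neg, zpow_ofNat, ← div_eq_mul_inv, mul_div_assoc']
    gcongr
    linarith
  have hlong : ∀ a b : ℂ, ‖a‖ ≤ C / √R → ‖b‖ ≤ C / (R * √R) → ‖a * conj b‖ ≤ C ^ 2 / R ^ 2 := by
    intro a b ha hb
    rw [norm_mul, RCLike.norm_conj]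
    calc ‖a‖ * ‖b‖ ≤ C / √R * (C / (R * √R)) := by gcongr
      _ = C ^ 2 / (R * (√R * √R)) := by field_simp
      _ = _ := by rw [hsq, sq R]
  have hlong' : ∀ a b : ℂ, ‖a‖ ≤ C / (R * √R) → ‖b‖ ≤ C / √R → ‖a * conj b‖ ≤ C ^ 2 / R ^ 2 := by
    intro a b ha hb
    have := hlong b a hb ha
    rw [norm_mul, RCLike.norm_conj] at this ⊢
    rwa [mul_comm]
  -- Giving up a factor `R ≥ 1` lets the diagonal-block leftovers use the same product estimate as
  -- the mixed blocks.
  have hshort : ∀ a : ℂ, ‖a‖ ≤ C / (R * √R) → ‖a‖ ≤ C / √R := fun a ha => by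
    refine ha.trans ?_
    gcongr
    nlinarith
  have hN0 : (0 : ℝ) ≤ N := N.cast_nonneg
  have hZ : (0 : ℝ) ≤ C ^ 2 / R ^ 2 := by positivity
  have hNn : ∀ z : ℂ, ‖z‖ ≤ 2 * (C ^ 2 / R ^ 2) → ‖(N : ℂ) * z‖ ≤ 2 * N * (C ^ 2 / R ^ 2) :=
    fun z hz => by
      rw [norm_mul, Complex.norm_natCast]
      nlinarith
  have hzero : (0 : ℝ) ≤ 2 * N * (C ^ 2 / R ^ 2) := by positivity
  simp only [matY, matZ, Matrix.fromBlocks_conjTranspose, Matrix.fromBlocks_multiply,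
    Matrix.fromBlocks_smul]
  intro l l'
  apply hfin
  rcases l with j | j <;> rcases l' with j' | j' <;>
    obtain ⟨h1, h2, h3, h4⟩ := hb R hR0 h j <;>
    simp only [Matrix.sub_apply, Matrix.fromBlocks_apply₁₁, Matrix.fromBlocks_apply₁₂,
      Matrix.fromBlocks_apply₂₁, Matrix.fromBlocks_apply₂₂, hgram, Matrix.smul_apply, matC, matD,
      Matrix.diagonal_apply, Matrix.zero_apply, smul_zero, sub_zero, smul_eq_mul] <;>
    split_ifs with hj <;>
    try simp only [mul_zero, sub_zero, norm_zero, hzero]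
  · rw [← mul_sub, add_sub_cancel_left]
    exact hNn _ ((hlong _ _ (hshort _ h2) h2).trans (by linarith))
  · exact hNn _ ((norm_add_le _ _).trans
      (by linarith [hlong _ _ h1 h3, hlong' _ _ h2 h4]))
  · exact hNn _ ((norm_add_le _ _).trans
      (by linarith [hlong' _ _ h3 h1, hlong _ _ h4 h2]))
  · rw [← mul_sub, add_sub_cancel_right]
    exact hNn _ ((hlong _ _ (hshort _ h3) h3).trans (by linarith))
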